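/- Let $\mathcal S,\mathcal A$ be finite sets with $|\mathcal S|=S$ and $|\mathcal A|=A$, let $H,K\ge 1$ be integers (the horizon and the number of episodes), let $p$ be a probability distribution on $\mathcal S$, and let $P$ be a transition kernel, i.e. $P(\cdot\mid s,a,h)$ is a probability distribution on $\mathcal S$ for each $(s,a,h)\in\mathcal S\times\mathcal A\times[H]$. A policy $\pi$ assigns to each $(s,h)$ a probability distribution $\pi(\cdot\mid s,h)$ on $\mathcal A$. For $\ell:\mathcal S\times\mathcal A\times[H]\to\mathbb R$ put $V_1^\pi(\ell,P)=\mathbb E\big[\sum_{h=1}^H\ell(s_h,a_h,h)\big]$, where $s_1\sim p$, $a_h\sim\pi(\cdot\mid s_h,h)$ and $s_{h+1}\sim P(\cdot\mid s_h,a_h,h)$ for $h\in[H]$. A learner interacts with this process for $K$ episodes: before episode $k$ it chooses a policy from the information available so far (the trajectories of the earlier episodes and any further observations or internal randomness), and, conditionally on that information, the trajectory $(s_1,a_1,\dots,s_H,a_H,s_{H+1})$ of episode $k$ is generated by $p$, that policy and $P$. Let $N_k(s,a,h)$ and $M_k(s,a,s',h)$ be the numbers of episodes among the first $k-1$ in which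 $(s_h,a_h)=(s,a)$, respectively $(s_h,a_h,s_{h+1})=(s,a,s')$. Fix $\delta\in(0,1)$ and write $L=\ln(HSAK/\delta)$, $n_k(s,a,h)=\max\{1,N_k(s,a,h)-1\}$, $\bar P_k(s'\mid s,a,h)=M_k(s,a,s',h)/\max\{1,N_k(s,a,h)\}$ and $$\epsilon_k(s'\mid s,a,h)=2\sqrt{\frac{\bar P_k(s'\mid s,a,h)\,L}{n_k(s,a,h)}}+\frac{14L}{3n_k(s,a,h)}.$$ Let $\mathcal P_k$ be the set of transition kernels $\widehat P$ with $|\widehat P(s'\mid s,a,h)-\bar P_k(s'\mid s,a,h)|\le\epsilon_k(s'\mid s,a,h)$ for all $(s,a,s',h)$. Define $$U_k(s,a,h)=8\sqrt H\,\varepsilon_k(s,a,h)+4S\sqrt{\frac{HA}{K}}+\frac{2\sqrt{HK/A}\,L+\eta}{n_k(s,a,h)},$$ $$\varepsilon_k(s,a,h)=2\sqrt{\frac{S L}{n_k(s,a,h)}}+\frac{14SL}{3n_k(s,a,h)},\qquad \eta=\big(19HS+2H^{1.5}S+10^4H^2S^2\big)L^2 .$$ Then, with probability at least $1-14\delta$,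 $$\big|V_1^{\pi_k}(g,P)-V_1^{\pi_k}(g,P_k)\big|\le V_1^{\pi_k}(U_k,P_k)$$ for every episode $k\in[K]$, every policy $\pi_k$, every $P_k\in\mathcal P_k$ and every $g:\mathcal S\times\mathcal A\times[H]\to[0,1]$. -/

import Mathlib

open MeasureTheory ProbabilityTheory

noncomputable section

namespace CMDP

/-- A trajectory of one episode with horizon `H`: the states `s_1, …, s_{H+1}` (indexed by
`Fin (H + 1)`) and the actions `a_1, …, a_H` (indexed by `Fin H`; index `h` is step `h + 1`). -/
abbrev Traj (S A : Type*) (H : ℕ) : Type _ := (Fin (H + 1) → S) × (Fin H → A)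

/-- `P h s a s'` is the probability of moving from `s` to `s'` under action `a` at step `h`. -/
def IsKernel {S A : Type*} [Fintype S] {H : ℕ} (P : Fin H → S → A → S → ℝ) : Prop :=
  ∀ h s a, P h s a ∈ stdSimplex ℝ S

/-- `π h s a` is the probability of playing action `a` in state `s` at step `h`. -/
def IsPolicy {S A : Type*} [Fintype A] {H : ℕ} (π : Fin H → S → A → ℝ) : Prop :=
  ∀ h s, π h s ∈ stdSimplex ℝ A

/-- The probability of the trajectory `τ` when `s_1 ∼ p`, `a_h ∼ π(· ∣ s_h, h)` and
`s_{h+1} ∼ P(· ∣ s_h, a_h, h)`. -/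
def trajProb {S A : Type*} {H : ℕ} (p : S → ℝ) (P : Fin H → S → A → S → ℝ)
    (π : Fin H → S → A → ℝ) (τ : Traj S A H) : ℝ :=
  p (τ.1 0) * ∏ h : Fin H,
    (π h (τ.1 h.castSucc) (τ.2 h) * P h (τ.1 h.castSucc) (τ.2 h) (τ.1 h.succ))

/-- `V_1^π(ℓ, P)`: the expected value of `∑_h ℓ(s_h, a_h, h)` over the trajectory generated by
the initial distribution `p`, the policy `π` and the kernel `P`. -/
def value {S A : Type*} [Fintype S] [Fintype A] {H : ℕ} (p : S → ℝ) (π : Fin H → S → A → ℝ)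
    (ℓ : Fin H → S → A → ℝ) (P : Fin H → S → A → S → ℝ) : ℝ :=
  ∑ τ : Traj S A H, trajProb p P π τ * ∑ h : Fin H, ℓ h (τ.1 h.castSucc) (τ.2 h)

/-- Episodic interaction of an arbitrary adaptive learner with the MDP `(p, P)` over `K` episodes.
`ℱ k` is the information available before episode `k`: it contains the trajectories of all earlier
episodes, and it may contain anything else (noisy reward and cost observations, internal
randomness). The policy `π k` is chosen from that information, and, given it, the trajectory
`X k` of episode `k` is generated by `p`, `π k` and `P`. -/
structure IsLearningRun {S A : Type*} [Fintype S] [Fintype A] {H K : ℕ}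
    {Ω : Type*} [mΩ : MeasurableSpace Ω] (μ : Measure Ω) (p : S → ℝ)
    (P : Fin H → S → A → S → ℝ) (ℱ : Filtration (Fin K) mΩ)
    (π : Fin K → Ω → Fin H → S → A → ℝ) (X : Fin K → Ω → Traj S A H) : Prop where
  isPolicy : ∀ k ω, IsPolicy (π k ω)
  policy_measurable : ∀ k h s a, Measurable[ℱ k] fun ω => π k ω h s a
  traj_measurable : ∀ k τ, MeasurableSet (X k ⁻¹' {τ})
  past_measurable : ∀ j k τ, j < k → MeasurableSet[ℱ k] (X j ⁻¹' {τ})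
  traj_law : ∀ k τ,
    μ[(X k ⁻¹' {τ}).indicator (fun _ => (1 : ℝ)) | ℱ k] =ᵐ[μ] fun ω => trajProb p P (π k ω) τ

section Estimators

variable {S A : Type*} [DecidableEq S] [DecidableEq A] {H K : ℕ}

/-- `N_k(s, a, h)`: the number of episodes before `k` that visit `(s, a)` at step `h`. -/
def visits (x : Fin K → Traj S A H) (k : Fin K) (h : Fin H) (s : S) (a : A) : ℕ :=
  (Finset.univ.filter fun j : Fin K =>
    j < k ∧ (x j).1 h.castSucc = s ∧ (x j).2 h = a).card

/-- `M_k(s, a, s', h)`: the number of episodes before `k` that visit `(s, a)` at step `h` and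
then move to `s'`. -/
def transitions (x : Fin K → Traj S A H) (k : Fin K) (h : Fin H) (s : S) (a : A) (s' : S) : ℕ :=
  (Finset.univ.filter fun j : Fin K =>
    j < k ∧ (x j).1 h.castSucc = s ∧ (x j).2 h = a ∧ (x j).1 h.succ = s').card

/-- The empirical transition kernel `M_k(s, a, s', h) / max {1, N_k(s, a, h)}`. -/
def empKernel (x : Fin K → Traj S A H) (k : Fin K) (h : Fin H) (s : S) (a : A) (s' : S) : ℝ :=
  (transitions x k h s a s' : ℝ) / max 1 (visits x k h s a : ℝ)

/-- `max {1, N_k(s, a, h) - 1}`, with the subtraction taken in the reals. -/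
def effVisits (x : Fin K → Traj S A H) (k : Fin K) (h : Fin H) (s : S) (a : A) : ℝ :=
  max 1 ((visits x k h s a : ℝ) - 1)

/-- `ln (H S A K / δ)`. -/
def logTerm (S A : Type*) [Fintype S] [Fintype A] (H K : ℕ) (δ : ℝ) : ℝ :=
  Real.log ((H : ℝ) * (Fintype.card S : ℝ) * (Fintype.card A : ℝ) * (K : ℝ) / δ)

variable [Fintype S] [Fintype A]

/-- The confidence radius `ϵ_k(s' ∣ s, a, h)`. -/
def radius (δ : ℝ) (x : Fin K → Traj S A H) (k : Fin K) (h : Fin H) (s : S) (a : A) (s' : S) : ℝ :=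
  2 * Real.sqrt (empKernel x k h s a s' * logTerm S A H K δ / effVisits x k h s a)
    + 14 * logTerm S A H K δ / (3 * effVisits x k h s a)

/-- The confidence set `𝒫_k`. -/
def confidenceSet (δ : ℝ) (x : Fin K → Traj S A H) (k : Fin K) : Set (Fin H → S → A → S → ℝ) :=
  {Q | IsKernel Q ∧ ∀ h s a s', |Q h s a s' - empKernel x k h s a s'| ≤ radius δ x k h s a s'}

/-- `ε_k(s, a, h)`. -/
def vareps (δ : ℝ) (x : Fin K → Traj S A H) (k : Fin K) (h : Fin H) (s : S) (a : A) : ℝ :=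
  2 * Real.sqrt ((Fintype.card S : ℝ) * logTerm S A H K δ / effVisits x k h s a)
    + 14 * (Fintype.card S : ℝ) * logTerm S A H K δ / (3 * effVisits x k h s a)

/-- `η = (19 H S + 2 H^{1.5} S + 10^4 H^2 S^2) (ln (H S A K / δ))^2`. -/
def eta (S A : Type*) [Fintype S] [Fintype A] (H K : ℕ) (δ : ℝ) : ℝ :=
  (19 * (H : ℝ) * (Fintype.card S : ℝ) + 2 * (H : ℝ) ^ (3 / 2 : ℝ) * (Fintype.card S : ℝ)
    + 10 ^ 4 * (H : ℝ) ^ 2 * (Fintype.card S : ℝ) ^ 2) * logTerm S A H K δ ^ 2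

/-- The extra pessimism `U_k(s, a, h)`. -/
def pessimism (δ : ℝ) (x : Fin K → Traj S A H) (k : Fin K) (h : Fin H) (s : S) (a : A) : ℝ :=
  8 * Real.sqrt (H : ℝ) * vareps δ x k h s a
    + 4 * (Fintype.card S : ℝ) * Real.sqrt ((H : ℝ) * (Fintype.card A : ℝ) / (K : ℝ))
    + (2 * Real.sqrt ((H : ℝ) * (K : ℝ) / (Fintype.card A : ℝ)) * logTerm S A H K δ
        + eta S A H K δ) / effVisits x k h s a

end Estimators

end CMDP

end

noncomputable section

namespace CMDP

/-! ### Backward recursion for values -/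

section Values

/-! The argument has a probabilistic and a deterministic half. Fix an index `(s, a, s', h)` and
write `P` for `P h s a s'`. For `|t| ≤ 1` the process `exp (t (M_k - N_k P) - t ^ 2 N_k P)` is a
supermartingale over the episodes, because `e ^ t ≤ 1 + t + t ^ 2`. Chernoff's bound and a union
over indices, episodes, signs and visit counts give `CountsConcentrate` outside an event of
probability at most `2 δ`. On that event every `Q ∈ 𝒫_k` satisfies `|P - Q| ≤ 5 √(Q x) + 40 x` with
`x = L / n_k`. The event involves no policy, reward or element of `𝒫_k`, so the conclusion holds for
all of them at once.

The rest is deterministic. Exchanging `Q` for `P` at one step costs about `√x` times the standard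
deviation of the next value `V` under `Q`, which AM-GM splits into `c Var_Q V` plus a multiple of `x
/ c`. The variances are summed with the potential `2 R V - V ^ 2`, where `R = H`: since `Var_Q V +
E_Q (2 R V - V ^ 2) = 2 R E_Q V - (E_Q V) ^ 2`, the induction in `abs_stateValue_sub_le` closes, and
the variances contribute at most a constant times `c H ^ 2`. The product of `P - Q` with the error
at the next step is absorbed by a factor `1 + lam` per step, harmless for `lam = 1 / (10 H)`.

Choosing `c H` of order `S √(H A / K)` produces the constant term of `U_k` and the `√(H K / A)`
term; `η` absorbs the lower-order terms, and the nonnegative `ε_k` term is simply discarded. -/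

theorem trajProb_cons {S A : Type*} {m : ℕ} (p : S → ℝ) (P : Fin (m + 1) → S → A → S → ℝ)
    (π : Fin (m + 1) → S → A → ℝ) (s : S) (a : A) (τ : Traj S A m) :
    trajProb p P π ((Fin.cons s τ.1 : Fin (m + 2) → S), (Fin.cons a τ.2 : Fin (m + 1) → A))
      = p s * π 0 s a *
        trajProb (P 0 s a) (fun i => P i.succ) (fun i => π i.succ) τ := by
  simp only [trajProb, Fin.prod_univ_succ, Fin.cons_zero, Fin.cons_succ, Fin.castSucc_zero,
    ← Fin.succ_castSucc]
  ring

variable {S A : Type*} [Fintype S] [Fintype A]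

/-- The value at the first step as a function of the initial state, by backward recursion. -/
def stateValue : {m : ℕ} → (Fin m → S → A → ℝ) → (Fin m → S → A → ℝ) →
    (Fin m → S → A → S → ℝ) → S → ℝ
  | 0, _, _, _ => fun _ => 0
  | _ + 1, π, ℓ, P => fun s => ∑ a, π 0 s a *
      (ℓ 0 s a + ∑ s', P 0 s a s' *
        stateValue (fun i => π i.succ) (fun i => ℓ i.succ) (fun i => P i.succ) s')

theorem sum_traj_succ {m : ℕ} (F : Traj S A (m + 1) → ℝ) :
    ∑ τ, F τ = ∑ s, ∑ a, ∑ τ : Traj S A m,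
      F ((Fin.cons s τ.1 : Fin (m + 2) → S), (Fin.cons a τ.2 : Fin (m + 1) → A)) := by
  rw [Fintype.sum_prod_type]
  rw [← (Fin.consEquiv (fun _ : Fin (m + 2) => S)).sum_comp, Fintype.sum_prod_type]
  refine Finset.sum_congr rfl fun s _ => ?_
  simp_rw [← (Fin.consEquiv (fun _ : Fin (m + 1) => A)).sum_comp, Fintype.sum_prod_type]
  rw [Finset.sum_comm]
  rfl

theorem sum_trajProb {m : ℕ} (p : S → ℝ) (P : Fin m → S → A → S → ℝ) (hP : IsKernel P)
    (π : Fin m → S → A → ℝ) (hπ : IsPolicy π) :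
    ∑ τ, trajProb p P π τ = ∑ s, p s := by
  induction m generalizing p with
  | zero =>
    rw [Fintype.sum_prod_type]
    simp only [trajProb, Finset.univ_eq_empty, Finset.prod_empty, mul_one, Finset.sum_const,
      Finset.card_univ, Fintype.card_unique, one_smul]
    exact (Equiv.funUnique (Fin 1) S).sum_comp p
  | succ m ih =>
    rw [sum_traj_succ]
    simp_rw [trajProb_cons, ← Finset.mul_sum]
    refine Finset.sum_congr rfl fun s _ => ?_
    have : ∀ a, ∑ τ, trajProb (P 0 s a) (fun i => P i.succ) (fun i => π i.succ) τ = 1 := fun a => by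
      rw [ih (P 0 s a) (fun i => P i.succ) (fun i => hP i.succ) (fun i => π i.succ)
        (fun i => hπ i.succ), (hP 0 s a).2]
    simp_rw [this, mul_one, ← Finset.mul_sum, (hπ 0 s).2, mul_one]

/-- For a kernel whose rows have total mass at most one, so have the trajectories. -/
theorem sum_trajProb_le {m : ℕ} (p : S → ℝ) (hp : 0 ≤ p) (P : Fin m → S → A → S → ℝ)
    (hP0 : ∀ h s a s', 0 ≤ P h s a s') (hP1 : ∀ h s a, ∑ s', P h s a s' ≤ 1)
    (π : Fin m → S → A → ℝ) (hπ : IsPolicy π) :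
    ∑ τ, trajProb p P π τ ≤ ∑ s, p s := by
  induction m generalizing p with
  | zero => exact (sum_trajProb p P (fun h => h.elim0) π hπ).le
  | succ m ih =>
    rw [sum_traj_succ]
    simp_rw [trajProb_cons, ← Finset.mul_sum]
    refine Finset.sum_le_sum fun s _ => ?_
    calc _ ≤ ∑ a, p s * π 0 s a := Finset.sum_le_sum fun a _ =>
          mul_le_of_le_one_right (mul_nonneg (hp s) ((hπ 0 s).1 a))
            ((ih (P 0 s a) (hP0 0 s a) (fun i => P i.succ) (fun i => hP0 i.succ)
              (fun i => hP1 i.succ) (fun i => π i.succ) (fun i => hπ i.succ)).trans (hP1 0 s a))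
      _ = p s := by rw [← Finset.mul_sum, (hπ 0 s).2, mul_one]

theorem value_eq_sum_stateValue {m : ℕ} (p : S → ℝ) (P : Fin m → S → A → S → ℝ) (hP : IsKernel P)
    (π : Fin m → S → A → ℝ) (hπ : IsPolicy π) (ℓ : Fin m → S → A → ℝ) :
    value p π ℓ P = ∑ s, p s * stateValue π ℓ P s := by
  induction m generalizing p with
  | zero => simp [value, stateValue]
  | succ m ih =>
    rw [value, sum_traj_succ]
    simp_rw [trajProb_cons, stateValue, Finset.mul_sum]
    refine Finset.sum_congr rfl fun s _ => Finset.sum_congr rfl fun a _ => ?_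
    have h1 := sum_trajProb (P 0 s a) (fun i => P i.succ) (fun i => hP i.succ) (fun i => π i.succ)
        (fun i => hπ i.succ)
    rw [(hP 0 s a).2] at h1
    have h2 := ih (P 0 s a) (fun i => P i.succ) (fun i => hP i.succ) (fun i => π i.succ)
        (fun i => hπ i.succ) (fun i => ℓ i.succ)
    rw [← h2, value]
    simp only [Fin.sum_univ_succ, Fin.cons_zero, Fin.cons_succ, Fin.castSucc_zero,
      ← Fin.succ_castSucc, mul_assoc, ← Finset.mul_sum, mul_add,
      Finset.sum_add_distrib, ← Finset.sum_mul, h1]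
    ring

theorem stateValue_mono {m : ℕ} {P : Fin m → S → A → S → ℝ} (hP : IsKernel P)
    {π : Fin m → S → A → ℝ} (hπ : IsPolicy π) {ℓ ℓ' : Fin m → S → A → ℝ}
    (h : ∀ i s a, ℓ i s a ≤ ℓ' i s a) (s : S) :
    stateValue π ℓ P s ≤ stateValue π ℓ' P s := by
  induction m generalizing s with
  | zero => exact le_rfl
  | succ m ih =>
    refine Finset.sum_le_sum fun a _ => mul_le_mul_of_nonneg_left (add_le_add (h 0 s a) ?_)
      ((hπ 0 s).1 a)
    exact Finset.sum_le_sum fun s' _ => mul_le_mul_of_nonneg_left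
      (ih (fun i => hP i.succ) (fun i => hπ i.succ) (fun i => h i.succ) s') ((hP 0 s a).1 s')

theorem stateValue_const_add {m : ℕ} {P : Fin m → S → A → S → ℝ} (hP : IsKernel P)
    {π : Fin m → S → A → ℝ} (hπ : IsPolicy π) (c : ℝ) (ℓ : Fin m → S → A → ℝ) (s : S) :
    stateValue π (fun i s a => c + ℓ i s a) P s = m * c + stateValue π ℓ P s := by
  induction m generalizing s with
  | zero => simp [stateValue]
  | succ m ih =>
    have h (s') := ih (fun i => hP i.succ) (fun i => hπ i.succ) (fun i => ℓ i.succ) s'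
    simp only [stateValue, h, mul_add, Finset.sum_add_distrib, ← Finset.sum_mul, (hP 0 s _).2,
      (hπ 0 s).2]
    push_cast
    ring

theorem stateValue_mul {m : ℕ} (P : Fin m → S → A → S → ℝ)
    (π : Fin m → S → A → ℝ) (c : ℝ) (ℓ : Fin m → S → A → ℝ) (s : S) :
    stateValue π (fun i s a => c * ℓ i s a) P s = c * stateValue π ℓ P s := by
  induction m generalizing s with
  | zero => simp [stateValue]
  | succ m ih =>
    have h (s') := ih (fun i => P i.succ) (fun i => π i.succ) (fun i => ℓ i.succ) s'
    simp only [stateValue, h, Finset.mul_sum]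
    refine Finset.sum_congr rfl fun a _ => ?_
    simp_rw [mul_left_comm _ c, ← Finset.mul_sum]
    ring

theorem stateValue_mem_Icc {m : ℕ} {P : Fin m → S → A → S → ℝ} (hP : IsKernel P)
    {π : Fin m → S → A → ℝ} (hπ : IsPolicy π) {g : Fin m → S → A → ℝ}
    (hg : ∀ i s a, g i s a ∈ Set.Icc (0 : ℝ) 1) (s : S) :
    stateValue π g P s ∈ Set.Icc (0 : ℝ) m := by
  -- Scaling by 0 evaluates the zero reward, and adding the constant 1 to it evaluates the unit
  -- reward; monotonicity does the rest.
  have h0 := stateValue_mul P π 0 (fun _ _ _ => 0) s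
  have h1 := stateValue_const_add hP hπ 1 (fun _ _ _ => 0) s
  simp only [zero_mul, add_zero, mul_one] at h0 h1
  rw [h0, add_zero] at h1
  exact ⟨h0 ▸ stateValue_mono hP hπ (fun i s a => (hg i s a).1) s,
    h1 ▸ stateValue_mono hP hπ (fun i s a => (hg i s a).2) s⟩

end Values

/-! ### Effect of a kernel perturbation on the value -/

section Perturbation

/-- AM-GM with weight `c`: the difference of the two sides is a completed square. With `t` a centred
value it yields a variance term. -/
theorem mul_sqrt_mul_le {q x α c t : ℝ} (hq : 0 ≤ q) (hx : 0 ≤ x) (hc : 0 < c) :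
    α * √(q * x) * t ≤ c * (q * t ^ 2) + α ^ 2 * x / (4 * c) := by
  rw [Real.sqrt_mul hq]
  have h1 := Real.sq_sqrt hq
  have h2 := Real.sq_sqrt hx
  have h : c * (q * t ^ 2) + α ^ 2 * x / (4 * c) - α * (√q * √x) * t
      = (2 * c * √q * t - α * √x) ^ 2 / (4 * c) := by
    field_simp
    rw [sub_sq, mul_pow, mul_pow, mul_pow, mul_pow, h1, h2]
    ring
  have : 0 ≤ (2 * c * √q * t - α * √x) ^ 2 / (4 * c) := by positivity
  linarith

theorem sum_mul_sub_sq {S : Type*} [Fintype S] {q : S → ℝ} (hq : q ∈ stdSimplex ℝ S) (v : S → ℝ) :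
    ∑ s, q s * (v s - ∑ s, q s * v s) ^ 2 = ∑ s, q s * v s ^ 2 - (∑ s, q s * v s) ^ 2 := by
  set M := ∑ s, q s * v s with hM
  have : ∀ s, q s * (v s - M) ^ 2 = q s * v s ^ 2 - 2 * M * (q s * v s) + q s * M ^ 2 :=
    fun s => by ring
  simp_rw [this, Finset.sum_add_distrib, Finset.sum_sub_distrib, ← Finset.mul_sum,
    ← Finset.sum_mul, hq.2, ← hM]
  ring

/-- The effect of replacing the distribution `q` by `p` and the function `v` by `v + d`, when
`|p - q|` is controlled by a Bernstein-type radius. -/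
theorem abs_expect_sub_expect_le {S : Type*} [Fintype S] {p q v d : S → ℝ} {x α β R c lam : ℝ}
    (hp : p ∈ stdSimplex ℝ S) (hq : q ∈ stdSimplex ℝ S) (hx : 0 ≤ x) (hβ : 0 ≤ β)
    (hc : 0 < c) (hlam : 0 < lam) (hv : ∀ s, v s ∈ Set.Icc 0 R) (hd : ∀ s, |d s| ≤ R)
    (hpq : ∀ s, |p s - q s| ≤ α * √(q s * x) + β * x) :
    |∑ s, p s * (v s + d s) - ∑ s, q s * v s|
      ≤ c * (∑ s, q s * v s ^ 2 - (∑ s, q s * v s) ^ 2) + (1 + lam) * ∑ s, q s * |d s|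
        + Fintype.card S * (α ^ 2 / (4 * c) + R * (2 * β + α ^ 2 / (4 * lam))) * x := by
  set M := ∑ s, q s * v s with hM
  have hM0 : 0 ≤ M := Finset.sum_nonneg fun s _ => mul_nonneg (hq.1 s) (hv s).1
  have hM1 : M ≤ R := by
    calc M ≤ ∑ s, q s * R :=
          Finset.sum_le_sum fun s _ => mul_le_mul_of_nonneg_left (hv s).2 (hq.1 s)
      _ = R := by rw [← Finset.sum_mul, hq.2, one_mul]
  have hR : 0 ≤ R := hM0.trans hM1
  -- Both distributions have mass one, so `v` may be centred at its `q`-mean; this is what makes the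
  -- variance appear.
  have hdecomp : ∑ s, p s * (v s + d s) - M
      = ∑ s, ((p s - q s) * (v s - M) + (p s - q s) * d s + q s * d s) := by
    have : ∀ s, (p s - q s) * (v s - M) + (p s - q s) * d s + q s * d s
        = p s * (v s + d s) - q s * v s - (p s - q s) * M := fun s => by ring
    simp_rw [this, Finset.sum_sub_distrib, ← Finset.sum_mul, Finset.sum_sub_distrib, hp.2, hq.2]
    ring
  rw [hdecomp, ← sum_mul_sub_sq hq v, ← hM]
  have hterm : ∀ s, |(p s - q s) * (v s - M) + (p s - q s) * d s + q s * d s|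
      ≤ c * (q s * (v s - M) ^ 2) + (1 + lam) * (q s * |d s|)
        + (α ^ 2 / (4 * c) + R * (2 * β + α ^ 2 / (4 * lam))) * x := fun s => by
    have hq0 := hq.1 s
    have hvM : |v s - M| ≤ R := abs_le.2 ⟨by linarith [(hv s).1], by linarith [(hv s).2]⟩
    have e1 : |(p s - q s) * (v s - M)|
        ≤ c * (q s * (v s - M) ^ 2) + α ^ 2 * x / (4 * c) + β * x * R := by
      rw [abs_mul]
      calc |p s - q s| * |v s - M| ≤ (α * √(q s * x) + β * x) * |v s - M| := by
            gcongr; exact hpq s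
        _ = α * √(q s * x) * |v s - M| + β * x * |v s - M| := by ring
        _ ≤ _ := by
            have := mul_sqrt_mul_le (α := α) (t := |v s - M|) hq0 hx hc
            rw [sq_abs] at this
            gcongr
    have e2 : |(p s - q s) * d s|
        ≤ lam * (q s * |d s|) + α ^ 2 * x / (4 * lam) * R + β * x * R := by
      rw [abs_mul]
      -- AM-GM is applied to the radius alone: one part returns as `lam * q * |d|`, and in the
      -- others `|d|` is bounded by `R`.
      have := mul_sqrt_mul_le (α := α) (t := 1) hq0 hx hlam
      calc |p s - q s| * |d s| ≤ (α * √(q s * x) + β * x) * |d s| := by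
            gcongr; exact hpq s
        _ ≤ (lam * q s + α ^ 2 * x / (4 * lam) + β * x) * |d s| := by
            gcongr; linarith
        _ = lam * (q s * |d s|) + α ^ 2 * x / (4 * lam) * |d s| + β * x * |d s| := by ring
        _ ≤ _ := by gcongr <;> exact hd s
    have e3 : |q s * d s| = q s * |d s| := by rw [abs_mul, abs_of_nonneg hq0]
    calc _ ≤ |(p s - q s) * (v s - M)| + |(p s - q s) * d s| + |q s * d s| := abs_add_three _ _ _
      _ ≤ _ := add_le_add_three e1 e2 e3.le
      _ = _ := by ring
  calc _ ≤ ∑ s, |(p s - q s) * (v s - M) + (p s - q s) * d s + q s * d s| :=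
        Finset.abs_sum_le_sum_abs _ _
    _ ≤ _ := Finset.sum_le_sum fun s _ => hterm s
    _ = _ := by
      simp only [Finset.sum_add_distrib, ← Finset.mul_sum, Finset.sum_const, Finset.card_univ,
        nsmul_eq_mul]
      ring

/-- Jensen's inequality for `y ↦ 2 R y - y ^ 2`, combined with monotonicity on `y ≤ R`. -/
theorem sum_two_mul_sub_sq_le {A : Type*} [Fintype A] {w g b : A → ℝ} {R : ℝ}
    (hw : w ∈ stdSimplex ℝ A) (hg : ∀ a, 0 ≤ g a) (hb : ∀ a, g a + b a ≤ R) :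
    ∑ a, w a * (2 * R * b a - b a ^ 2)
      ≤ 2 * R * ∑ a, w a * (g a + b a) - (∑ a, w a * (g a + b a)) ^ 2 := by
  set V := ∑ a, w a * (g a + b a) with hV
  have h : ∀ a, w a * (2 * R * b a - b a ^ 2)
      ≤ 2 * R * (w a * (g a + b a)) - (2 * V * (w a * (g a + b a)) - w a * V ^ 2) := fun a => by
    have hw0 := hw.1 a
    -- With `y = g a + b a`, the gap is `2 g (R - y) + g ^ 2 + (y - V) ^ 2`; the last square comes
    -- from the tangent to `y ^ 2` at `V`.
    have : 2 * R * b a - b a ^ 2 ≤ 2 * R * (g a + b a) - (2 * V * (g a + b a) - V ^ 2) := by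
      nlinarith [sq_nonneg (g a + b a - V), mul_nonneg (hg a) (sub_nonneg.2 (hb a)),
        mul_nonneg (hg a) (hg a)]
    calc _ ≤ w a * (2 * R * (g a + b a) - (2 * V * (g a + b a) - V ^ 2)) := by gcongr
      _ = _ := by ring
  calc _ ≤ _ := Finset.sum_le_sum fun a _ => h a
    _ = _ := by
      simp_rw [Finset.sum_sub_distrib, ← Finset.mul_sum, ← Finset.sum_mul, hw.2, ← hV]
      ring

variable {S A : Type*} [Fintype S] [Fintype A]

/-- The potential `2 R V - V ^ 2` is the induction hypothesis that pays for the variances. `R` stays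
fixed while the horizon `m` shrinks, so the potential is always evaluated where it is increasing. -/
theorem abs_stateValue_sub_le {m : ℕ} {P Q : Fin m → S → A → S → ℝ} {π g x : Fin m → S → A → ℝ}
    {α β R c lam : ℝ} (hP : IsKernel P) (hQ : IsKernel Q) (hπ : IsPolicy π)
    (hg : ∀ h s a, g h s a ∈ Set.Icc (0 : ℝ) 1) (hx : ∀ h s a, 0 ≤ x h s a)
    (hβ : 0 ≤ β) (hc : 0 < c) (hlam : 0 < lam) (hR : m ≤ R)
    (hPQ : ∀ h s a s', |P h s a s' - Q h s a s'| ≤ α * √(Q h s a s' * x h s a) + β * x h s a)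
    (s : S) :
    |stateValue π g P s - stateValue π g Q s|
      ≤ (1 + lam) ^ m * (c * (2 * R * stateValue π g Q s - stateValue π g Q s ^ 2)
        + stateValue π (fun h s a => Fintype.card S *
            (α ^ 2 / (4 * c) + R * (2 * β + α ^ 2 / (4 * lam))) * x h s a) Q s) := by
  induction m generalizing s with
  | zero => simp [stateValue]
  | succ m ih =>
    set C : ℝ := Fintype.card S * (α ^ 2 / (4 * c) + R * (2 * β + α ^ 2 / (4 * lam))) with hC
    have hmR : (m : ℝ) ≤ R := by push_cast at hR; linarith
    have hR0 : 0 ≤ R := le_trans (Nat.cast_nonneg m) hmR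
    have hC0 : 0 ≤ C := by positivity
    have hPt : IsKernel fun i : Fin m => P i.succ := fun i => hP i.succ
    have hQt : IsKernel fun i : Fin m => Q i.succ := fun i => hQ i.succ
    have hπt : IsPolicy fun i : Fin m => π i.succ := fun i => hπ i.succ
    specialize ih hPt hQt hπt (fun i => hg i.succ) (fun i => hx i.succ) hmR (fun i => hPQ i.succ)
    have hu := stateValue_mem_Icc hPt hπt (fun i => hg i.succ)
    have hv := stateValue_mem_Icc hQt hπt (fun i => hg i.succ)
    simp only [stateValue]
    set u := stateValue (fun i : Fin m => π i.succ) (fun i => g i.succ) (fun i => P i.succ)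
    set v := stateValue (fun i : Fin m => π i.succ) (fun i => g i.succ) (fun i => Q i.succ)
    set y := stateValue (fun i : Fin m => π i.succ) (fun i s a => C * x i.succ s a)
      (fun i => Q i.succ)
    have hG : (1 : ℝ) ≤ (1 + lam) ^ (m + 1) := one_le_pow₀ (by linarith)
    have hrow : ∀ a, |∑ s', P 0 s a s' * u s' - ∑ s', Q 0 s a s' * v s'|
        ≤ (1 + lam) ^ (m + 1) * (c * (2 * R * ∑ s', Q 0 s a s' * v s'
          - (∑ s', Q 0 s a s' * v s') ^ 2) + (C * x 0 s a + ∑ s', Q 0 s a s' * y s')) := fun a => by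
      have h1 := abs_expect_sub_expect_le (v := v) (d := fun s' => u s' - v s') (R := R)
        (hP 0 s a) (hQ 0 s a) (hx 0 s a) hβ hc hlam
        (fun s' => ⟨(hv s').1, (hv s').2.trans hmR⟩)
        (fun s' => abs_le.2 ⟨by linarith [(hu s').1, (hv s').2], by linarith [(hu s').2, (hv s').1]⟩)
        (hPQ 0 s a)
      simp only [add_sub_cancel, ← hC] at h1
      have h2 : ∑ s', Q 0 s a s' * |u s' - v s'| ≤ (1 + lam) ^ m *
          (c * (2 * R * ∑ s', Q 0 s a s' * v s' - ∑ s', Q 0 s a s' * v s' ^ 2)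
            + ∑ s', Q 0 s a s' * y s') := by
        calc _ ≤ ∑ s', Q 0 s a s' * ((1 + lam) ^ m * (c * (2 * R * v s' - v s' ^ 2) + y s')) :=
              Finset.sum_le_sum fun s' _ => mul_le_mul_of_nonneg_left (ih s') ((hQ 0 s a).1 s')
          _ = _ := by
              simp only [Finset.mul_sum, ← Finset.sum_sub_distrib, ← Finset.sum_add_distrib]
              exact Finset.sum_congr rfl fun s' _ => by ring
      have hvar : 0 ≤ ∑ s', Q 0 s a s' * v s' ^ 2 - (∑ s', Q 0 s a s' * v s') ^ 2 := by
        rw [← sum_mul_sub_sq (hQ 0 s a)]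
        exact Finset.sum_nonneg fun s' _ => mul_nonneg ((hQ 0 s a).1 s') (sq_nonneg _)
      have hD : 0 ≤ c * (∑ s', Q 0 s a s' * v s' ^ 2 - (∑ s', Q 0 s a s' * v s') ^ 2)
          + C * x 0 s a := add_nonneg (mul_nonneg hc.le hvar) (mul_nonneg hC0 (hx 0 s a))
      -- The propagated error takes the exponent from `m` to `m + 1`; the cost of the current step
      -- is nonnegative, so it may carry the same factor.
      have h3 := mul_le_mul_of_nonneg_left h2 (by linarith : 0 ≤ 1 + lam)
      have h4 := le_mul_of_one_le_left hD hG
      rw [← mul_assoc, ← pow_succ'] at h3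
      calc _ ≤ _ := h1
        _ ≤ (1 + lam) ^ (m + 1) *
            (c * (∑ s', Q 0 s a s' * v s' ^ 2 - (∑ s', Q 0 s a s' * v s') ^ 2) + C * x 0 s a)
            + (1 + lam) ^ (m + 1) *
          (c * (2 * R * ∑ s', Q 0 s a s' * v s' - ∑ s', Q 0 s a s' * v s' ^ 2)
            + ∑ s', Q 0 s a s' * y s') := by linarith
        -- The second moment of `v` cancels between the variance and the averaged potential.
        _ = _ := by ring
    have hb : ∀ a, g 0 s a + ∑ s', Q 0 s a s' * v s' ≤ R := fun a => by
      have : ∑ s', Q 0 s a s' * v s' ≤ m := by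
        calc _ ≤ ∑ s', Q 0 s a s' * m := Finset.sum_le_sum fun s' _ =>
              mul_le_mul_of_nonneg_left (hv s').2 ((hQ 0 s a).1 s')
          _ = m := by rw [← Finset.sum_mul, (hQ 0 s a).2, one_mul]
      push_cast at hR
      linarith [(hg 0 s a).2]
    have hJ := sum_two_mul_sub_sq_le (hπ 0 s) (fun a => (hg 0 s a).1) hb
    rw [← Finset.sum_sub_distrib]
    calc _ ≤ ∑ a, |π 0 s a * (g 0 s a + ∑ s', P 0 s a s' * u s')
            - π 0 s a * (g 0 s a + ∑ s', Q 0 s a s' * v s')| := Finset.abs_sum_le_sum_abs _ _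
      _ ≤ ∑ a, π 0 s a * ((1 + lam) ^ (m + 1) * (c * (2 * R * ∑ s', Q 0 s a s' * v s'
          - (∑ s', Q 0 s a s' * v s') ^ 2) + (C * x 0 s a + ∑ s', Q 0 s a s' * y s'))) := by
          refine Finset.sum_le_sum fun a _ => ?_
          rw [← mul_sub, abs_mul, abs_of_nonneg ((hπ 0 s).1 a), add_sub_add_left_eq_sub]
          exact mul_le_mul_of_nonneg_left (hrow a) ((hπ 0 s).1 a)
      _ = (1 + lam) ^ (m + 1) * (c * ∑ a, π 0 s a * (2 * R * ∑ s', Q 0 s a s' * v s'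
          - (∑ s', Q 0 s a s' * v s') ^ 2)
          + ∑ a, π 0 s a * (C * x 0 s a + ∑ s', Q 0 s a s' * y s')) := by
          rw [Finset.mul_sum, ← Finset.sum_add_distrib, Finset.mul_sum]
          exact Finset.sum_congr rfl fun a _ => by ring
      _ ≤ _ := by gcongr

/-- Value difference bound with the sum of the variances bounded by `H ^ 2`. -/
theorem abs_value_sub_le {H : ℕ} {p : S → ℝ} (hp : p ∈ stdSimplex ℝ S)
    {P Q : Fin H → S → A → S → ℝ} {π g x : Fin H → S → A → ℝ}
    {α β c lam : ℝ} (hP : IsKernel P) (hQ : IsKernel Q) (hπ : IsPolicy π)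
    (hg : ∀ h s a, g h s a ∈ Set.Icc (0 : ℝ) 1) (hx : ∀ h s a, 0 ≤ x h s a)
    (hβ : 0 ≤ β) (hc : 0 < c) (hlam : 0 < lam)
    (hPQ : ∀ h s a s', |P h s a s' - Q h s a s'| ≤ α * √(Q h s a s' * x h s a) + β * x h s a) :
    |value p π g P - value p π g Q|
      ≤ value p π (fun h s a => (1 + lam) ^ H * (c * H + Fintype.card S *
            (α ^ 2 / (4 * c) + H * (2 * β + α ^ 2 / (4 * lam))) * x h s a)) Q := by
  rw [value_eq_sum_stateValue p P hP π hπ, value_eq_sum_stateValue p Q hQ π hπ,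
    value_eq_sum_stateValue p Q hQ π hπ, ← Finset.sum_sub_distrib]
  refine (Finset.abs_sum_le_sum_abs _ _).trans (Finset.sum_le_sum fun s _ => ?_)
  rw [← mul_sub, abs_mul, abs_of_nonneg (hp.1 s), stateValue_mul Q π ((1 + lam) ^ H),
    stateValue_const_add hQ hπ]
  refine mul_le_mul_of_nonneg_left ?_ (hp.1 s)
  refine (abs_stateValue_sub_le hP hQ hπ hg hx hβ hc hlam le_rfl hPQ s).trans ?_
  -- The potential is at most `H ^ 2`; written as `H` copies of `c * H`, it becomes a constant
  -- reward per step.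
  have : c * (2 * H * stateValue π g Q s - stateValue π g Q s ^ 2) ≤ H * (c * H) := by
    nlinarith [mul_nonneg hc.le (sq_nonneg ((H : ℝ) - stateValue π g Q s))]
  gcongr

end Perturbation

/-! ### Exponential supermartingale and Chernoff bounds -/

section Concentration

/-- Exponential moment bound for a centred Bernoulli variable. -/
theorem sum_mul_exp_le_one {S : Type*} [Fintype S] [DecidableEq S] {q : S → ℝ}
    (hq : q ∈ stdSimplex ℝ S) (s' : S) {t : ℝ} (ht : |t| ≤ 1) :
    ∑ s, q s * Real.exp (t * ((if s = s' then 1 else 0) - q s') - t ^ 2 * q s') ≤ 1 := by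
  have h1 : ∀ s, q s * Real.exp (t * ((if s = s' then 1 else 0) - q s') - t ^ 2 * q s')
      = Real.exp (-(t * q s') - t ^ 2 * q s') *
        (q s + if s = s' then q s * (Real.exp t - 1) else 0) := fun s => by
    split_ifs
    · rw [show t * (1 - q s') - t ^ 2 * q s' = (-(t * q s') - t ^ 2 * q s') + t by ring,
        Real.exp_add]
      ring
    · rw [show t * (0 - q s') - t ^ 2 * q s' = -(t * q s') - t ^ 2 * q s' by ring]
      ring
  simp_rw [h1, ← Finset.mul_sum, Finset.sum_add_distrib, hq.2, Finset.sum_ite_eq',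
    Finset.mem_univ, if_true]
  -- The moment generating function is at most a Poisson one, after which `e ^ t - 1 - t ≤ t ^ 2` on
  -- `|t| ≤ 1` finishes.
  have h2 : 1 + q s' * (Real.exp t - 1) ≤ Real.exp (q s' * (Real.exp t - 1)) := by
    rw [add_comm]; exact Real.add_one_le_exp _
  have h3 := (abs_le.1 (Real.abs_exp_sub_one_sub_id_le ht)).2
  calc _ ≤ Real.exp (-(t * q s') - t ^ 2 * q s') * Real.exp (q s' * (Real.exp t - 1)) := by gcongr
    _ = Real.exp (q s' * (Real.exp t - 1 - t - t ^ 2)) := by rw [← Real.exp_add]; ring_nf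
    _ ≤ 1 := Real.exp_le_one_iff.2 (mul_nonpos_of_nonneg_of_nonpos (hq.1 s') (by linarith))

theorem measurable_comp_of_finite {Ω β : Type*} [Finite β] {m : MeasurableSpace Ω} {Y : Ω → β}
    (hY : ∀ b, MeasurableSet[m] (Y ⁻¹' {b})) (z : β → ℝ) : Measurable[m] fun ω => z (Y ω) := by
  let _ : MeasurableSpace β := ⊤
  have : Measurable[m] Y := @measurable_to_countable' β Ω _ _ m Y hY
  exact (measurable_from_top (f := z)).comp this

/-- The weight whose product over the episodes before `k` is
`exp (t (M_k - N_k P) - t ^ 2 N_k P)`. -/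
def expWeight {S A : Type*} {H : ℕ} [DecidableEq S] [DecidableEq A] (P : Fin H → S → A → S → ℝ) (h : Fin H) (s : S)
    (a : A) (s' : S) (t : ℝ) (τ : Traj S A H) : ℝ :=
  Real.exp (t * ((if τ.1 h.castSucc = s ∧ τ.2 h = a ∧ τ.1 h.succ = s' then 1 else 0)
      - (if τ.1 h.castSucc = s ∧ τ.2 h = a then 1 else 0) * P h s a s')
    - t ^ 2 * ((if τ.1 h.castSucc = s ∧ τ.2 h = a then 1 else 0) * P h s a s'))

theorem prod_expWeight {S A : Type*} [DecidableEq S] [DecidableEq A] {H K : ℕ}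
    (P : Fin H → S → A → S → ℝ) (x : Fin K → Traj S A H) (k : Fin K) (h : Fin H) (s : S) (a : A) (s' : S)
    (t : ℝ) :
    ∏ j ∈ Finset.univ.filter (fun j : Fin K => j.val < k.val), expWeight P h s a s' t (x j)
      = Real.exp (t * (transitions x k h s a s' - visits x k h s a * P h s a s')
          - t ^ 2 * (visits x k h s a * P h s a s')) := by
  simp only [expWeight]
  rw [← Real.exp_sum]
  simp only [Finset.sum_sub_distrib, ← Finset.mul_sum, ← Finset.sum_mul, Finset.sum_boole,
    Finset.filter_filter]
  rfl

variable {S A : Type*} [Fintype S] [Fintype A] {H K : ℕ}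
    {Ω : Type*} [mΩ : MeasurableSpace Ω] {μ : Measure Ω} {p : S → ℝ}
    {P : Fin H → S → A → S → ℝ} {ℱ : Filtration (Fin K) mΩ}
    {π : Fin K → Ω → Fin H → S → A → ℝ} {X : Fin K → Ω → Traj S A H}

/-- The weight sees only the transition at step `h`, so it can be absorbed into the kernel there.
The tilted rows have mass at most one by `sum_mul_exp_le_one`, and `sum_trajProb_le` applies. -/
theorem sum_trajProb_mul_expWeight_le_one [DecidableEq S] [DecidableEq A]
    (hp : p ∈ stdSimplex ℝ S) (hP : IsKernel P) {ρ : Fin H → S → A → ℝ} (hρ : IsPolicy ρ)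
    (h : Fin H) (s : S) (a : A) (s' : S) {t : ℝ} (ht : |t| ≤ 1) :
    ∑ τ, trajProb p P ρ τ * expWeight P h s a s' t τ ≤ 1 := by
  set f : S → A → S → ℝ := fun u b u' =>
    Real.exp (t * ((if u = s ∧ b = a ∧ u' = s' then 1 else 0)
      - (if u = s ∧ b = a then 1 else 0) * P h s a s')
    - t ^ 2 * ((if u = s ∧ b = a then 1 else 0) * P h s a s')) with hf
  have hsum : ∀ u b, ∑ u', P h u b u' * f u b u' ≤ 1 := fun u b => by
    by_cases hub : u = s ∧ b = a
    · obtain ⟨rfl, rfl⟩ := hub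
      simpa [hf] using sum_mul_exp_le_one (hP h u b) s' ht
    · have h1 : ∀ u', ¬ (u = s ∧ b = a ∧ u' = s') := fun u' h => hub ⟨h.1, h.2.1⟩
      simp [hf, hub, h1, (hP h u b).2]
  set P' : Fin H → S → A → S → ℝ := fun i u b u' => P i u b u' * if i = h then f u b u' else 1
  have hprob : ∀ τ, trajProb p P ρ τ * expWeight P h s a s' t τ = trajProb p P' ρ τ := fun τ => by
    have : expWeight P h s a s' t τ
        = ∏ i : Fin H, if i = h then f (τ.1 i.castSucc) (τ.2 i) (τ.1 i.succ) else 1 := by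
      rw [Finset.prod_ite_eq' Finset.univ h fun i => f (τ.1 i.castSucc) (τ.2 i) (τ.1 i.succ)]
      simp [expWeight, hf]
    rw [this, trajProb, trajProb, mul_assoc, ← Finset.prod_mul_distrib]
    simp only [P', mul_assoc]
  simp_rw [hprob]
  rw [← hp.2]
  refine sum_trajProb_le p hp.1 P' (fun i u b u' => mul_nonneg ((hP i u b).1 u') ?_)
    (fun i u b => ?_) ρ hρ
  · split_ifs
    · exact (Real.exp_pos _).le
    · exact zero_le_one
  · by_cases hi : i = h
    · subst hi; simpa [P'] using hsum u b
    · simp [P', hi, (hP i u b).2]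

theorem exists_abs_prod_le {β : Type*} [Finite β] (z : β → ℝ) (J : Finset (Fin K)) :
    ∃ C, ∀ Y : Fin K → β, ‖∏ j ∈ J, z (Y j)‖ ≤ C := by
  obtain ⟨C, hC⟩ := (Set.finite_range fun b => |z b|).bddAbove
  refine ⟨∏ _j ∈ J, C, fun Y => ?_⟩
  rw [Real.norm_eq_abs, Finset.abs_prod]
  exact Finset.prod_le_prod (fun _ _ => abs_nonneg _) fun j _ => hC ⟨Y j, rfl⟩

/-- Supermartingale step: condition on `ℱ k` for the last episode and pull out the past product. The
one-episode bound `hz` holds for every policy, so the adaptive choice of `π k` costs nothing. -/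
theorem integral_prod_le_one [IsProbabilityMeasure μ] (hrun : IsLearningRun μ p P ℱ π X)
    {z : Traj S A H → ℝ} (hz0 : ∀ τ, 0 ≤ z τ)
    (hz : ∀ ρ, IsPolicy ρ → ∑ τ, trajProb p P ρ τ * z τ ≤ 1) (n : ℕ) (hn : n ≤ K) :
    ∫ ω, ∏ j ∈ Finset.univ.filter (fun j : Fin K => j.val < n), z (X j ω) ∂μ ≤ 1 := by
  classical
  induction n with
  | zero => simp
  | succ n ih =>
    specialize ih (by omega)
    set k : Fin K := ⟨n, hn⟩
    have hset : Finset.univ.filter (fun j : Fin K => j.val < n + 1)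
        = insert k (Finset.univ.filter (fun j : Fin K => j.val < n)) := by
      ext j
      simp only [Finset.mem_filter, Finset.mem_univ, true_and, Finset.mem_insert, k, Fin.ext_iff]
      omega
    rw [hset]
    simp_rw [Finset.prod_insert (show k ∉ Finset.univ.filter (fun j : Fin K => j.val < n) by simp [k])]
    set W : Ω → ℝ := fun ω => ∏ j ∈ Finset.univ.filter (fun j : Fin K => j.val < n), z (X j ω)
      with hW
    have hW0 : ∀ ω, 0 ≤ W ω := fun ω => Finset.prod_nonneg fun j _ => hz0 _
    have hWm : Measurable[ℱ k] W := by
      refine Finset.measurable_fun_prod _ fun j hj => ?_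
      exact measurable_comp_of_finite
        (fun τ => hrun.past_measurable j k τ (by simpa [k, Fin.lt_def] using hj)) z
    have hWm' : Measurable W := hWm.mono (ℱ.le k) le_rfl
    obtain ⟨C, hC⟩ := exists_abs_prod_le z (Finset.univ.filter (fun j : Fin K => j.val < n))
    have hWint : Integrable W μ :=
      Integrable.of_bound hWm'.aestronglyMeasurable C (ae_of_all _ fun ω => hC fun j => X j ω)
    have hind : ∀ τ, Integrable ((X k ⁻¹' {τ}).indicator (fun _ => (1 : ℝ))) μ := fun τ =>
      (integrable_const 1).indicator (hrun.traj_measurable k τ)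
    have hWind : ∀ τ, Integrable (W * (X k ⁻¹' {τ}).indicator (fun _ => (1 : ℝ))) μ := fun τ => by
      refine (hWint.indicator (hrun.traj_measurable k τ)).congr (ae_of_all _ fun ω => ?_)
      by_cases h : ω ∈ X k ⁻¹' {τ} <;> simp [Set.indicator, h]
    have hcond : ∀ τ, W * μ[(X k ⁻¹' {τ}).indicator (fun _ => (1 : ℝ)) | ℱ k]
        =ᵐ[μ] fun ω => W ω * trajProb p P (π k ω) τ := fun τ => by
      filter_upwards [hrun.traj_law k τ] with ω hω
      rw [Pi.mul_apply, hω]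
    have hpull : ∀ τ, μ[W * (X k ⁻¹' {τ}).indicator (fun _ => (1 : ℝ)) | ℱ k]
        =ᵐ[μ] fun ω => W ω * trajProb p P (π k ω) τ := fun τ =>
      (condExp_mul_of_stronglyMeasurable_left hWm.stronglyMeasurable (hWind τ) (hind τ)).trans
        (hcond τ)
    have h_integrable : ∀ τ, Integrable (fun ω => W ω * trajProb p P (π k ω) τ) μ := fun τ =>
      integrable_condExp.congr (hpull τ)
    have hEq : ∀ τ, ∫ ω, (W * (X k ⁻¹' {τ}).indicator (fun _ => (1 : ℝ))) ω ∂μ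
        = ∫ ω, W ω * trajProb p P (π k ω) τ ∂μ := fun τ => by
      rw [← integral_condExp (ℱ.le k)]
      exact integral_congr_ae (hpull τ)
    -- The conditional law is given on singletons, so the weight is expanded over the finitely many
    -- trajectories.
    have hexp : ∀ ω, z (X k ω) * W ω
        = ∑ τ, z τ * (W * (X k ⁻¹' {τ}).indicator (fun _ => (1 : ℝ))) ω := fun ω => by
      rw [Finset.sum_eq_single (X k ω)]
      · simp
      · intro τ _ hτ
        simp [Set.indicator, Ne.symm hτ]
      · simp
    calc ∫ ω, z (X k ω) * W ω ∂μ
        = ∑ τ, z τ * ∫ ω, (W * (X k ⁻¹' {τ}).indicator (fun _ => (1 : ℝ))) ω ∂μ := by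
          simp_rw [hexp]
          rw [integral_finsetSum _ fun τ _ => (hWind τ).const_mul (z τ)]
          simp_rw [integral_const_mul]
      _ = ∫ ω, ∑ τ, z τ * (W ω * trajProb p P (π k ω) τ) ∂μ := by
          rw [integral_finsetSum _ fun τ _ => (h_integrable τ).const_mul (z τ)]
          simp_rw [integral_const_mul, hEq]
      _ ≤ ∫ ω, W ω ∂μ := by
          refine integral_mono (integrable_finsetSum _ fun τ _ => (h_integrable τ).const_mul (z τ)) hWint
            fun ω => ?_
          calc ∑ τ, z τ * (W ω * trajProb p P (π k ω) τ)
              = W ω * ∑ τ, trajProb p P (π k ω) τ * z τ := by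
                rw [Finset.mul_sum]; exact Finset.sum_congr rfl fun τ _ => by ring
            _ ≤ W ω := mul_le_of_le_one_right (hW0 ω) (hz _ (hrun.isPolicy k ω))
      _ ≤ 1 := ih

variable [DecidableEq S] [DecidableEq A]

/-- Chernoff bound at a fixed parameter `t`. -/
theorem measureReal_exp_le [IsProbabilityMeasure μ] (hp : p ∈ stdSimplex ℝ S) (hP : IsKernel P)
    (hrun : IsLearningRun μ p P ℱ π X) (k : Fin K) (h : Fin H) (s : S) (a : A) (s' : S)
    {t : ℝ} (ht : |t| ≤ 1) (y : ℝ) :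
    μ.real {ω | y ≤ t * (transitions (fun j => X j ω) k h s a s'
        - visits (fun j => X j ω) k h s a * P h s a s')
          - t ^ 2 * (visits (fun j => X j ω) k h s a * P h s a s')} ≤ Real.exp (-y) := by
  have h1 := integral_prod_le_one hrun (z := expWeight P h s a s' t) (fun τ => (Real.exp_pos _).le)
    (fun ρ hρ => sum_trajProb_mul_expWeight_le_one hp hP hρ h s a s' ht) k.val k.isLt.le
  simp_rw [prod_expWeight P (fun j => X j _)] at h1
  have h_integrable : Integrable (fun ω => Real.exp (t * (transitions (fun j => X j ω) k h s a s'
        - visits (fun j => X j ω) k h s a * P h s a s')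
          - t ^ 2 * (visits (fun j => X j ω) k h s a * P h s a s'))) μ := by
    simp_rw [← prod_expWeight P (fun j => X j _)]
    obtain ⟨C, hC⟩ := exists_abs_prod_le (expWeight P h s a s' t)
      (Finset.univ.filter (fun j : Fin K => j.val < k.val))
    refine Integrable.of_bound (Measurable.aestronglyMeasurable ?_) C
      (ae_of_all _ fun ω => hC fun j => X j ω)
    exact Finset.measurable_fun_prod _ fun j _ =>
      measurable_comp_of_finite (hrun.traj_measurable j) _
  have h2 := mul_meas_ge_le_integral_of_nonneg (ae_of_all _ fun ω => (Real.exp_pos _).le) h_integrable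
    (Real.exp y)
  simp only [Real.exp_le_exp] at h2
  rw [Real.exp_neg, ← one_div, le_div_iff₀ (Real.exp_pos y), mul_comm]
  exact h2.trans h1

/-- The witness is `√(y / v)`, capped at 1 because the moment bound needs `|t| ≤ 1`. -/
theorem exists_chernoff_parameter {v y : ℝ} (hv : 0 ≤ v) (hy : 0 ≤ y) :
    ∃ t, 0 ≤ t ∧ t ≤ 1 ∧ y ≤ t * (2 * √(v * y) + y) - t ^ 2 * v := by
  rcases le_or_gt v y with hvy | hvy
  · refine ⟨1, zero_le_one, le_rfl, ?_⟩
    have : v ≤ √(v * y) := Real.le_sqrt_of_sq_le (by nlinarith)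
    nlinarith
  · have hv' : 0 < v := hy.trans_lt hvy
    refine ⟨√(y / v), Real.sqrt_nonneg _, Real.sqrt_le_one.2 ((div_le_one hv').2 hvy.le), ?_⟩
    have e1 : √(y / v) * √(v * y) = y := by
      rw [← Real.sqrt_mul (by positivity), show y / v * (v * y) = y ^ 2 by field_simp,
        Real.sqrt_sq hy]
    have e2 : √(y / v) ^ 2 * v = y := by
      rw [Real.sq_sqrt (by positivity)]; field_simp
    nlinarith [mul_nonneg (Real.sqrt_nonneg (y / v)) hy]

/-- Bernstein-type deviation of the transition counts at a prescribed number of visits. -/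
theorem measureReal_deviation_le [IsProbabilityMeasure μ] (hp : p ∈ stdSimplex ℝ S)
    (hP : IsKernel P) (hrun : IsLearningRun μ p P ℱ π X) (k : Fin K) (n : ℕ) (h : Fin H) (s : S)
    (a : A) (s' : S) {y : ℝ} (hy : 0 ≤ y) {σ : ℝ} (hσ : |σ| = 1) :
    μ.real {ω | visits (fun j => X j ω) k h s a = n ∧
      2 * √(n * P h s a s' * y) + y
        ≤ σ * (transitions (fun j => X j ω) k h s a s' - n * P h s a s')} ≤ Real.exp (-y) := by
  have hq := (hP h s a).1 s'
  -- The parameter depends on the number of visits, and must not be random; hence the visit count is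
  -- prescribed as `n`.
  obtain ⟨t, ht0, ht1, ht⟩ := exists_chernoff_parameter (v := n * P h s a s') (by positivity) hy
  have hσt : |σ * t| ≤ 1 := by rw [abs_mul, hσ, one_mul, abs_of_nonneg ht0]; exact ht1
  refine (measureReal_mono ?_).trans (measureReal_exp_le hp hP hrun k h s a s' hσt y)
  rintro ω ⟨hN, hM⟩
  have hσ2 : σ ^ 2 = 1 := by rw [← sq_abs, hσ, one_pow]
  simp only [Set.mem_ofPred_eq, hN, mul_pow, hσ2, one_mul]
  nlinarith [mul_le_mul_of_nonneg_left hM ht0]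

end Concentration

/-! ### Arithmetic of Bernstein radii -/

section Bernstein

/-- Two Bernstein-type radii around `r` combine to one in terms of the other centre. -/
theorem abs_sub_le_of_bernstein {p q r x : ℝ} (hp : 0 ≤ p) (hq : 0 ≤ q) (hr : 0 ≤ r) (hx : 0 ≤ x)
    (hqr : |q - r| ≤ 2 * √(r * x) + 14 / 3 * x) (hrp : |r - p| ≤ 2 * √(2 * (p * x)) + 2 * x) :
    |p - q| ≤ 5 * √(q * x) + 40 * x := by
  have h2 : √2 ≤ 1.415 := Real.sqrt_le_iff.2 (by norm_num)
  rw [Real.sqrt_mul hr] at hqr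
  rw [Real.sqrt_mul zero_le_two, Real.sqrt_mul hp] at hrp
  rw [Real.sqrt_mul hq]
  have ea := Real.sq_sqrt hq
  have eb := Real.sq_sqrt hr
  have ec := Real.sq_sqrt hp
  have ed := Real.sq_sqrt hx
  have ha := Real.sqrt_nonneg q
  have hb := Real.sqrt_nonneg r
  have hc := Real.sqrt_nonneg p
  have hd := Real.sqrt_nonneg x
  set a := √q
  set b := √r
  set c := √p
  set d := √x
  have hrp' : |r - p| ≤ 2.83 * (c * d) + 2 * x := by
    have := mul_le_mul_of_nonneg_right h2 (mul_nonneg hc hd)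
    linarith
  -- Each inequality is quadratic in a square root; 3.5 suffices for both, since `3.5 ^ 2` exceeds
  -- `2 * 3.5 + 14 / 3` and `2.83 * 3.5 + 2`.
  have hba : b ≤ a + 3.5 * d := by
    by_contra! hlt
    have := (abs_le.1 hqr).1
    nlinarith [mul_nonneg ha hd, mul_nonneg hd hd]
  have hcb : c ≤ b + 3.5 * d := by
    by_contra! hlt
    have := (abs_le.1 hrp').1
    nlinarith [mul_nonneg hb hd, mul_nonneg hd hd]
  have e1 := mul_le_mul_of_nonneg_right hba hd
  have e2 := mul_le_mul_of_nonneg_right (hcb.trans (by linarith : _ ≤ a + 7 * d)) hd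
  have e3 := mul_nonneg ha hd
  have h3 : |p - q| ≤ |q - r| + |r - p| := by
    rw [abs_sub_comm q r, abs_sub_comm r p, add_comm]; exact abs_sub_le p r q
  nlinarith

/-- For `N ≥ 1`, divide by `N` and use `max 1 (N - 1) ≤ N`. For `N = 0` the claim is trivial, as `q
≤ 1 ≤ 2 * L`. -/
theorem abs_freq_sub_le {M N : ℕ} {q L : ℝ} (hMN : M ≤ N) (hq : q ∈ Set.Icc (0 : ℝ) 1) (hL : 1 ≤ L)
    (h : |(M : ℝ) - N * q| ≤ 2 * √(N * q * (2 * L)) + 2 * L) :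
    |(M : ℝ) / max 1 (N : ℝ) - q|
      ≤ 2 * √(2 * (q * (L / max 1 ((N : ℝ) - 1)))) + 2 * (L / max 1 ((N : ℝ) - 1)) := by
  rcases Nat.eq_zero_or_pos N with rfl | hN
  · obtain rfl : M = 0 := by omega
    have : |(0 : ℝ) - q| ≤ 2 * L := by
      rw [zero_sub, abs_neg, abs_of_nonneg hq.1]; linarith [hq.2]
    norm_num at this ⊢
    have : 0 ≤ √2 * √(q * L) := by positivity
    linarith
  · have hN1 : (1 : ℝ) ≤ N := by exact_mod_cast hN
    have hN0 : (0 : ℝ) < N := by linarith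
    have hq0 := hq.1
    have hmax : max 1 ((N : ℝ) - 1) ≤ N := max_le hN1 (by linarith)
    have hmax0 : 0 < max 1 ((N : ℝ) - 1) := lt_max_of_lt_left one_pos
    have hle : L / N ≤ L / max 1 ((N : ℝ) - 1) := by gcongr
    rw [max_eq_right hN1]
    calc |(M : ℝ) / N - q| = |(M : ℝ) - N * q| / N := by
          rw [← abs_of_pos hN0, ← abs_div, abs_of_pos hN0]; congr 1; field_simp
      _ ≤ (2 * √(N * q * (2 * L)) + 2 * L) / N := by gcongr
      _ = 2 * √(2 * (q * (L / N))) + 2 * (L / N) := by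
          have : 2 * (q * (L / N)) = N * q * (2 * L) / N ^ 2 := by field_simp
          rw [this, Real.sqrt_div' _ (by positivity), Real.sqrt_sq hN0.le]
          ring
      _ ≤ _ := by gcongr

end Bernstein

/-! ### The good event and its consequence for the confidence set -/

section GoodEvent

theorem visits_lt {S A : Type*} [DecidableEq S] [DecidableEq A] {H K : ℕ}
    (x : Fin K → Traj S A H) (k : Fin K) (h : Fin H) (s : S) (a : A) :
    visits x k h s a < K := by
  refine lt_of_le_of_lt (Finset.card_le_card (t := Finset.Iio k) fun j hj => ?_) ?_
  · exact Finset.mem_Iio.2 (Finset.mem_filter.1 hj).2.1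
  · rw [Fin.card_Iio]; exact k.isLt

theorem transitions_le_visits {S A : Type*} [DecidableEq S] [DecidableEq A] {H K : ℕ}
    (x : Fin K → Traj S A H) (k : Fin K) (h : Fin H) (s : S) (a : A)
    (s' : S) : transitions x k h s a s' ≤ visits x k h s a :=
  Finset.card_le_card fun j hj => by
    simp only [Finset.mem_filter] at hj ⊢
    exact ⟨hj.1, hj.2.1, hj.2.2.1, hj.2.2.2.1⟩

variable {S A : Type*} [Fintype S] [Fintype A] [DecidableEq S] [DecidableEq A] {H K : ℕ}

/-- Every transition count is within a Bernstein-type radius of its conditional mean. -/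
def CountsConcentrate (P : Fin H → S → A → S → ℝ) (L : ℝ) (x : Fin K → Traj S A H) : Prop :=
  ∀ k h s a s', |(transitions x k h s a s' : ℝ) - visits x k h s a * P h s a s'|
    ≤ 2 * √(visits x k h s a * P h s a s' * (2 * L)) + 2 * L

theorem measureReal_not_countsConcentrate_le {Ω : Type*} [mΩ : MeasurableSpace Ω] {μ : Measure Ω}
    [IsProbabilityMeasure μ] {p : S → ℝ} (hp : p ∈ stdSimplex ℝ S)
    {P : Fin H → S → A → S → ℝ} (hP : IsKernel P) {ℱ : Filtration (Fin K) mΩ}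
    {π : Fin K → Ω → Fin H → S → A → ℝ} {X : Fin K → Ω → Traj S A H}
    (hrun : IsLearningRun μ p P ℱ π X) {L : ℝ} (hL : 0 ≤ L) :
    μ.real {ω | ¬ CountsConcentrate P L fun j => X j ω}
      ≤ 2 * (K * K * (H * (Fintype.card S * (Fintype.card A * Fintype.card S))))
        * Real.exp (-(2 * L)) := by
  set σ : Bool → ℝ := fun b => if b then 1 else -1
  have hσ : ∀ b, |σ b| = 1 := fun b => by cases b <;> simp [σ]
  -- The Boolean is the sign of the deviation; the second `Fin K` is the visit count, which is below
  -- `K` by `visits_lt`.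
  set B : Bool × (Fin K × Fin K) × Fin H × S × A × S → Set Ω := fun i =>
    {ω | visits (fun j => X j ω) i.2.1.1 i.2.2.1 i.2.2.2.1 i.2.2.2.2.1 = (i.2.1.2 : ℕ) ∧
      2 * √((i.2.1.2 : ℕ) * P i.2.2.1 i.2.2.2.1 i.2.2.2.2.1 i.2.2.2.2.2 * (2 * L)) + 2 * L
        ≤ σ i.1 * (transitions (fun j => X j ω) i.2.1.1 i.2.2.1 i.2.2.2.1 i.2.2.2.2.1 i.2.2.2.2.2
          - (i.2.1.2 : ℕ) * P i.2.2.1 i.2.2.2.1 i.2.2.2.2.1 i.2.2.2.2.2)} with hB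
  have hsub : {ω | ¬ CountsConcentrate P L fun j => X j ω} ⊆ ⋃ i, B i := by
    intro ω hω
    simp only [Set.mem_ofPred_eq, CountsConcentrate, not_forall, not_le] at hω
    obtain ⟨k, h, s, a, s', hlt⟩ := hω
    refine Set.mem_iUnion.2 ?_
    rcases lt_abs.1 hlt with h1 | h1
    · exact ⟨(true, (k, ⟨_, visits_lt (fun j => X j ω) k h s a⟩), h, s, a, s'), rfl, by
        simpa [σ] using h1.le⟩
    · exact ⟨(false, (k, ⟨_, visits_lt (fun j => X j ω) k h s a⟩), h, s, a, s'), rfl, by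
        simpa [σ] using h1.le⟩
  calc _ ≤ μ.real (⋃ i, B i) := measureReal_mono hsub
    _ ≤ ∑ i, μ.real (B i) := measureReal_iUnion_fintype_le _
    _ ≤ ∑ _i : Bool × (Fin K × Fin K) × Fin H × S × A × S, Real.exp (-(2 * L)) :=
        Finset.sum_le_sum fun i _ =>
          measureReal_deviation_le hp hP hrun _ _ _ _ _ _ (by linarith) (hσ i.1)
    _ = _ := by
        simp only [Finset.sum_const, Finset.card_univ, Fintype.card_prod, Fintype.card_bool,
          Fintype.card_fin, nsmul_eq_mul]
        push_cast
        ring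

/-- Under concentration of the counts, every kernel of the confidence set is close to `P`. -/
theorem CountsConcentrate.abs_sub_le {P : Fin H → S → A → S → ℝ} (hP : IsKernel P) {δ : ℝ}
    (hL : 1 ≤ logTerm S A H K δ) {x : Fin K → Traj S A H}
    (hx : CountsConcentrate P (logTerm S A H K δ) x) {k : Fin K} {Q : Fin H → S → A → S → ℝ}
    (hQ : Q ∈ confidenceSet δ x k) (h : Fin H) (s : S) (a : A) (s' : S) :
    |P h s a s' - Q h s a s'| ≤ 5 * √(Q h s a s' * (logTerm S A H K δ / effVisits x k h s a))
      + 40 * (logTerm S A H K δ / effVisits x k h s a) := by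
  have hn : 0 < effVisits x k h s a := lt_max_of_lt_left one_pos
  have hr : 0 ≤ empKernel x k h s a s' := by unfold empKernel; positivity
  have h1 := hQ.2 h s a s'
  have h2 := abs_freq_sub_le (transitions_le_visits x k h s a s') (mem_Icc_of_mem_stdSimplex (hP h s a) s')
    hL (hx k h s a s')
  refine abs_sub_le_of_bernstein ((hP h s a).1 s') ((hQ.1 h s a).1 s') hr (by positivity) ?_ h2
  refine h1.trans_eq ?_
  rw [radius, mul_div_assoc]
  congr 1
  field_simp

end GoodEvent

/-! ### Choice of constants and comparison with `U_k` -/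

section Pessimism

theorem one_add_pow_le {H : ℕ} (hH : 0 < H) : (1 + 1 / (10 * (H : ℝ))) ^ H ≤ 1.12 := by
  have hH' : (0 : ℝ) < H := by exact_mod_cast hH
  -- The bound `e ^ x ≤ 1 / (1 - x)` at `x = 1 / 10` gives `10 / 9 < 1.12`.
  have h := Real.exp_bound_div_one_sub_of_interval (x := 1 / 10) (by norm_num) (by norm_num)
  calc (1 + 1 / (10 * (H : ℝ))) ^ H ≤ Real.exp (1 / (10 * (H : ℝ))) ^ H := by
        gcongr; rw [add_comm]; exact Real.add_one_le_exp _
    _ = Real.exp (1 / 10) := by rw [← Real.exp_nat_mul]; congr 1; field_simp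
    _ ≤ 1.12 := h.trans (by norm_num)

/-- The value of `c` makes `1.12 * c * H` exactly the constant term of `U_k`. Then `1.12 * S * 25 /
(4 * c) = 1.96 * √(H K / A)`, just below the available factor 2, and the remaining terms fit in the
`10 ^ 4` part of `η`. -/
theorem perturbation_le_pessimism {S A : Type*} [Fintype S] [Fintype A] [DecidableEq S]
    [DecidableEq A] [Nonempty S] [Nonempty A] {H K : ℕ} (hH : 0 < H) (hK : 0 < K) {δ : ℝ}
    (hL : 1 ≤ logTerm S A H K δ) (x : Fin K → Traj S A H) (k : Fin K) (h : Fin H) (s : S) (a : A)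
    {c : ℝ} (hc : c = 4 * Fintype.card S * √(H * Fintype.card A / K) / (1.12 * H)) :
    (1 + 1 / (10 * (H : ℝ))) ^ H * (c * H + Fintype.card S * ((5 : ℝ) ^ 2 / (4 * c)
        + H * (2 * 40 + (5 : ℝ) ^ 2 / (4 * (1 / (10 * (H : ℝ)))))) *
          (logTerm S A H K δ / effVisits x k h s a))
      ≤ pessimism δ x k h s a := by
  have hn : 0 < effVisits x k h s a := lt_max_of_lt_left one_pos
  have hγ := one_add_pow_le hH
  have hve : 0 ≤ vareps δ x k h s a := by unfold vareps; positivity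
  rw [pessimism, eta]
  set L := logTerm S A H K δ
  set n := effVisits x k h s a
  have hS1 : (1 : ℝ) ≤ Fintype.card S := by exact_mod_cast Fintype.card_pos
  have hA1 : (1 : ℝ) ≤ Fintype.card A := by exact_mod_cast Fintype.card_pos
  have hH1 : (1 : ℝ) ≤ H := by exact_mod_cast hH
  have hK1 : (1 : ℝ) ≤ K := by exact_mod_cast hK
  have hHp : 0 ≤ (H : ℝ) ^ (3 / 2 : ℝ) := by positivity
  -- This identity turns the `1 / c` term into a multiple of `√(H K / A)`.
  have hww : √((H : ℝ) * Fintype.card A / K) * √((H : ℝ) * K / Fintype.card A) = H := by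
    rw [← Real.sqrt_mul (by positivity),
      show (H : ℝ) * Fintype.card A / K * ((H : ℝ) * K / Fintype.card A) = (H : ℝ) ^ 2 by
        field_simp, Real.sqrt_sq (by positivity)]
  have hw0 : 0 < √((H : ℝ) * Fintype.card A / K) := Real.sqrt_pos.2 (by positivity)
  have hw0' : 0 < √((H : ℝ) * K / Fintype.card A) := Real.sqrt_pos.2 (by positivity)
  generalize √((H : ℝ) * Fintype.card A / K) = w at *
  generalize √((H : ℝ) * K / Fintype.card A) = w' at *
  generalize (Fintype.card S : ℝ) = σ at *
  generalize (H : ℝ) ^ (3 / 2 : ℝ) = η₁ at *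
  generalize (1 + 1 / (10 * (H : ℝ))) ^ H = γ at *
  generalize (H : ℝ) = T at *
  have hT : 0 < T := by linarith
  have hσ : 0 < σ := by linarith
  have hc0 : 0 < c := by rw [hc]; positivity
  have e1 : 5 ^ 2 / (4 * c) = 1.75 * w' / σ := by
    rw [hc, ← hww]
    field_simp
    norm_num
  have e2 : 5 ^ 2 / (4 * (1 / (10 * T))) = 62.5 * T := by field_simp; norm_num
  have hx : 0 < L / n := by positivity
  calc _ ≤ 1.12 * (c * T + σ * ((5 : ℝ) ^ 2 / (4 * c)
        + T * (2 * 40 + (5 : ℝ) ^ 2 / (4 * (1 / (10 * T))))) * (L / n)) := by gcongr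
    _ = 4 * σ * w + (1.96 * w' * L + 1.12 * (σ * (T * (80 + 62.5 * T))) * L) / n := by
        rw [e1, e2, hc]
        field_simp
        ring
    _ ≤ _ := by
        have hTT : T ≤ T ^ 2 := by nlinarith
        have hσσ : σ ≤ σ ^ 2 := by nlinarith
        have hLL : L ≤ L ^ 2 := by nlinarith
        have f1 : 1.12 * (σ * (T * (80 + 62.5 * T))) ≤ 10 ^ 4 * T ^ 2 * σ ^ 2 := by
          calc _ = σ * (89.6 * T + 70 * T ^ 2) := by ring
            _ ≤ σ ^ 2 * (10 ^ 4 * T ^ 2) := by gcongr; nlinarith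
            _ = _ := by ring
        have f2 : 1.12 * (σ * (T * (80 + 62.5 * T))) * L
            ≤ (19 * T * σ + 2 * η₁ * σ + 10 ^ 4 * T ^ 2 * σ ^ 2) * L ^ 2 := by
          have : 0 ≤ 19 * T * σ + 2 * η₁ * σ := by positivity
          gcongr
          linarith
        have f3 : 0 ≤ 8 * √T * vareps δ x k h s a := by positivity
        have f4 : 1.96 * w' * L ≤ 2 * w' * L := by gcongr; norm_num
        have f5 := div_le_div_of_nonneg_right (add_le_add f4 f2) hn.le
        linarith

end Pessimism

end CMDP

end

/-! ### Conclusion -/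

theorem mainTheorem2 {S A : Type*} [Fintype S] [Fintype A] [DecidableEq S] [DecidableEq A]
    {H K : ℕ} {Ω : Type*} [mΩ : MeasurableSpace Ω] (μ : Measure Ω) [IsProbabilityMeasure μ]
    (p : S → ℝ) (hp : p ∈ stdSimplex ℝ S)
    (P : Fin H → S → A → S → ℝ) (hP : CMDP.IsKernel P)
    (ℱ : Filtration (Fin K) mΩ)
    (π : Fin K → Ω → Fin H → S → A → ℝ) (X : Fin K → Ω → CMDP.Traj S A H)
    (hrun : CMDP.IsLearningRun μ p P ℱ π X)
    (δ : ℝ) (hδ0 : 0 < δ) (hδ1 : δ < 1) :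
    1 - 14 * δ ≤ μ.real {ω | ∀ k : Fin K,
      ∀ πk : Fin H → S → A → ℝ, CMDP.IsPolicy πk →
      ∀ Pk ∈ CMDP.confidenceSet δ (fun j => X j ω) k,
      ∀ g : Fin H → S → A → ℝ, (∀ h s a, g h s a ∈ Set.Icc (0 : ℝ) 1) →
        |CMDP.value p πk g P - CMDP.value p πk g Pk|
          ≤ CMDP.value p πk (CMDP.pessimism δ (fun j => X j ω) k) Pk} := by
  -- In the nontrivial case `δ < 1 / 14`, so `H S A K / δ > e` once the sizes are positive; this is
  -- the source of `1 ≤ L`.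
  rcases le_or_gt 1 (14 * δ) with hδ | hδ
  · exact (sub_nonpos.2 hδ).trans measureReal_nonneg
  have hS : Nonempty S := by
    by_contra hS
    rw [not_nonempty_iff] at hS
    simpa using hp.2
  by_cases htriv : H = 0 ∨ K = 0 ∨ IsEmpty A
  · have huniv : ∀ E : Set Ω, (∀ ω, ω ∈ E) → 1 - 14 * δ ≤ μ.real E := fun E hE => by
      rw [Set.eq_univ_of_forall hE, probReal_univ]; linarith
    refine huniv _ fun ω k πk hπk Pk _ g _ => ?_
    rcases htriv with rfl | rfl | hA
    · simp [CMDP.value]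
    · exact k.elim0
    · rcases Nat.eq_zero_or_pos H with rfl | hH
      · simp [CMDP.value]
      · simpa using (hπk ⟨0, hH⟩ hS.some).2
  simp only [not_or, not_isEmpty_iff, ← Nat.pos_iff_ne_zero] at htriv
  obtain ⟨hH, hK, hA⟩ := htriv
  have hS1 : (1 : ℝ) ≤ Fintype.card S := by exact_mod_cast Fintype.card_pos
  have hA1 : (1 : ℝ) ≤ Fintype.card A := by exact_mod_cast Fintype.card_pos
  have hH1 : (1 : ℝ) ≤ H := by exact_mod_cast hH
  have hK1 : (1 : ℝ) ≤ K := by exact_mod_cast hK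
  have hL : 1 ≤ CMDP.logTerm S A H K δ := by
    rw [CMDP.logTerm, Real.le_log_iff_exp_le (by positivity), le_div_iff₀ hδ0]
    have h1 : (1 : ℝ) ≤ (H : ℝ) * Fintype.card S * Fintype.card A * K :=
      one_le_mul_of_one_le_of_one_le
        (one_le_mul_of_one_le_of_one_le (one_le_mul_of_one_le_of_one_le hH1 hS1) hA1) hK1
    nlinarith [Real.exp_one_lt_d9]
  have hbad : μ.real {ω | ¬ CMDP.CountsConcentrate P (CMDP.logTerm S A H K δ) fun j => X j ω}
      ≤ 2 * δ := by
    refine (CMDP.measureReal_not_countsConcentrate_le hp hP hrun (by linarith)).trans ?_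
    have hexp : Real.exp (-(2 * CMDP.logTerm S A H K δ))
        = (δ / ((H : ℝ) * Fintype.card S * Fintype.card A * K)) ^ 2 := by
      rw [← mul_neg, show (2 : ℝ) = ((2 : ℕ) : ℝ) by norm_num, Real.exp_nat_mul, Real.exp_neg,
        CMDP.logTerm, Real.exp_log (by positivity), inv_div]
    rw [hexp]
    -- Deviation level `2 * L` gives `(δ / (H S A K)) ^ 2` per event, enough to pay for the factors
    -- `K ^ 2` and `S ^ 2` in the union.
    calc _ = 2 * δ * (δ / (H * Fintype.card A)) := by field_simp
      _ ≤ 2 * δ * 1 := by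
          gcongr
          rw [div_le_one (by positivity)]
          exact hδ1.le.trans (one_le_mul_of_one_le_of_one_le hH1 hA1)
      _ = 2 * δ := mul_one _
  have hgood : 1 - 14 * δ
      ≤ μ.real {ω | CMDP.CountsConcentrate P (CMDP.logTerm S A H K δ) fun j => X j ω} := by
    -- Subadditivity on the event and its complement avoids proving the event measurable.
    have h1 := measureReal_union_le (μ := μ)
      {ω | CMDP.CountsConcentrate P (CMDP.logTerm S A H K δ) fun j => X j ω}
      {ω | CMDP.CountsConcentrate P (CMDP.logTerm S A H K δ) fun j => X j ω}ᶜ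
    rw [Set.union_compl_self, probReal_univ] at h1
    have h2 : μ.real {ω | CMDP.CountsConcentrate P (CMDP.logTerm S A H K δ) fun j => X j ω}ᶜ
      ≤ 2 * δ := hbad
    linarith
  refine hgood.trans (measureReal_mono ?_)
  intro ω hω k πk hπk Pk hPk g hg
  have hn : ∀ h s a, 0 < CMDP.effVisits (fun j => X j ω) k h s a :=
    fun _ _ _ => lt_max_of_lt_left one_pos
  have hc : 0 < 4 * (Fintype.card S : ℝ) * √((H : ℝ) * Fintype.card A / K) / (1.12 * H) := by
    have : 0 < √((H : ℝ) * Fintype.card A / K) := Real.sqrt_pos.2 (by positivity)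
    positivity
  refine (CMDP.abs_value_sub_le hp hP hPk.1 hπk hg
    (x := fun h s a => CMDP.logTerm S A H K δ / CMDP.effVisits (fun j => X j ω) k h s a)
    (fun h s a => div_nonneg (by linarith) (hn h s a).le) (α := 5) (β := 40) (by norm_num) hc
    (lam := 1 / (10 * (H : ℝ))) (by positivity)
    fun h s a s' => CMDP.CountsConcentrate.abs_sub_le hP hL hω hPk h s a s').trans ?_
  rw [CMDP.value_eq_sum_stateValue p Pk hPk.1 πk hπk, CMDP.value_eq_sum_stateValue p Pk hPk.1 πk hπk]
  exact Finset.sum_le_sum fun s _ => mul_le_mul_of_nonneg_left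
    (CMDP.stateValue_mono hPk.1 hπk (fun h s a =>
      CMDP.perturbation_le_pessimism hH hK hL (fun j => X j ω) k h s a rfl) s) (hp.1 s)
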